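/- Let $(M,g)$ be a smooth, compact, connected $n$-dimensional Riemannian manifold (Hausdorff, without boundary) with Riemannian connection $\nabla$. Let $\boldsymbol{u}$ be a smooth vector field and $f:M\to\mathbb{R}$ a smooth function, not identically zero, such that $\nabla_X\boldsymbol{u}=fX$ for all vector fields $X$; that is, $\boldsymbol{u}$ is a non-trivial concircular vector field with potential function $f$. Let $\rho:M\to\mathbb{R}$ be a connecting function of $\boldsymbol{u}$, that is, a smooth function such that the gradient of $f$ satisfies $\nabla f=\rho\,\boldsymbol{u}$. If $\rho(p)\neq 0$ for every $p\in M$ and $\boldsymbol{u}$ has exactly two zeros, then $M$ is homeomorphic to the $n$-sphere $S^n$. -/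

import Mathlib

open Bundle Manifold ContDiff VectorField

noncomputable section
namespace RiemGeom
set_option linter.unusedSectionVars false
variable {E : Type*} [NormedAddCommGroup E] [NormedSpace ℝ E] [FiniteDimensional ℝ E]
  {H : Type*} [TopologicalSpace H] {I : ModelWithCorners ℝ E H}
  {M : Type*} [TopologicalSpace M] [ChartedSpace H M] [IsManifold I ∞ M]
  (g : ContMDiffRiemannianMetric I ∞ E (fun x : M ↦ TangentSpace I x))

/-- The function `y ↦ g(Y, Z)(y)` is differentiable where `Y` and `Z` are. -/
theorem mdiff_inner {Y Z : Π x : M, TangentSpace I x} {x : M}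
    (hY : MDiffAt (T% Y) x) (hZ : MDiffAt (T% Z) x) :
    MDiffAt (fun y ↦ g.inner y (Y y) (Z y)) x := by
  have : MDifferentiableAt I (I.prod 𝓘(ℝ))
      (fun m ↦ TotalSpace.mk' ℝ (E := Bundle.Trivial M ℝ) m (g.inner m (Y m) (Z m))) x := by
    apply MDifferentiableAt.clm_bundle_apply₂ (F₁ := E) (F₂ := E)
    · exact (g.contMDiff x).mdifferentiableAt (by simp)
    · exact hY
    · exact hZ
  simp only [mdifferentiableAt_totalSpace] at this
  exact this.2

theorem flat_injective (x : M) : Function.Injective (g.inner x) := by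
  rw [injective_iff_map_eq_zero]
  intro v hv
  by_contra h
  have := g.pos x v h
  simp [hv] at this

/-- The musical isomorphism `v ↦ g(v, ·)` from the tangent space at `x` to its dual. -/
def flat (x : M) : TangentSpace I x ≃ₗ[ℝ] (TangentSpace I x →L[ℝ] ℝ) :=
  haveI : FiniteDimensional ℝ (TangentSpace I x) := inferInstanceAs (FiniteDimensional ℝ E)
  haveI : T2Space (TangentSpace I x) := inferInstanceAs (T2Space E)
  LinearEquiv.ofInjectiveOfFinrankEq (g.inner x).toLinearMap (flat_injective g x)
    ((Subspace.dual_finrank_eq (K := ℝ) (V := TangentSpace I x)).symm.trans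
      (LinearMap.toContinuousLinearMap (𝕜 := ℝ) (E := TangentSpace I x) (F' := ℝ)).finrank_eq)

theorem flat_apply (x : M) (v w : TangentSpace I x) : flat g x v w = g.inner x v w := rfl

/-- The Riemannian gradient of `f`: the vector field with `g(∇f, v) = df(v)`. -/
def gradient (f : M → ℝ) (x : M) : TangentSpace I x := (flat g x).symm (mvfderiv I f x)

theorem inner_gradient (f : M → ℝ) (x : M) (v : TangentSpace I x) :
    g.inner x (gradient g f x) v = mvfderiv I f x v := by
  rw [← flat_apply, gradient, LinearEquiv.apply_symm_apply]

/-- The right-hand side of the Koszul formula for `2 g(∇_X Y, Z)` (note the order of the arguments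
`Y X Z`):
`X g(Y, Z) + Y g(X, Z) - Z g(X, Y) + g([X, Y], Z) - g([X, Z], Y) - g([Y, Z], X)`. -/
def koszul (Y X Z : Π x : M, TangentSpace I x) (x : M) : ℝ :=
  mvfderiv I (fun y ↦ g.inner y (Y y) (Z y)) x (X x)
  + mvfderiv I (fun y ↦ g.inner y (X y) (Z y)) x (Y x)
  - mvfderiv I (fun y ↦ g.inner y (X y) (Y y)) x (Z x)
  + g.inner x (mlieBracket I X Y x) (Z x)
  - g.inner x (mlieBracket I X Z x) (Y x)
  - g.inner x (mlieBracket I Y Z x) (X x)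

theorem koszul_tensorial_left {Y Z : Π x : M, TangentSpace I x} {x : M}
    (hY : MDiffAt (T% Y) x) (hZ : MDiffAt (T% Z) x) :
    TensorialAt I E (fun X ↦ koszul g Y X Z x) x where
  smul {f X} hf hX := by
    have e1 := mvfderiv_fun_mul hf (mdiff_inner g hX hZ)
    have e2 := mvfderiv_fun_mul hf (mdiff_inner g hX hY)
    simp only [koszul, Pi.smul_apply', map_smul, mlieBracket_smul_left hf hX,
      map_add, add_apply, smul_apply, smul_eq_mul, e1, e2]
    simp
    ring
  add {X X'} hX hX' := by
    have e1 := mvfderiv_fun_add (mdiff_inner g hX hZ) (mdiff_inner g hX' hZ)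
    have e2 := mvfderiv_fun_add (mdiff_inner g hX hY) (mdiff_inner g hX' hY)
    simp only [koszul, Pi.add_apply, map_add, add_apply,
      mlieBracket_add_left hX hX', e1, e2]
    ring

theorem koszul_tensorial_right {Y X : Π x : M, TangentSpace I x} {x : M}
    (hY : MDiffAt (T% Y) x) (hX : MDiffAt (T% X) x) :
    TensorialAt I E (fun Z ↦ koszul g Y X Z x) x where
  smul {f Z} hf hZ := by
    have e1 := mvfderiv_fun_mul hf (mdiff_inner g hY hZ)
    have e2 := mvfderiv_fun_mul hf (mdiff_inner g hX hZ)
    simp only [koszul, Pi.smul_apply', map_smul, mlieBracket_smul_right hf hZ,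
      map_add, add_apply, smul_apply, smul_eq_mul, e1, e2]
    rw [g.symm x (Z x) (X x), g.symm x (Z x) (Y x)]
    ring
  add {Z Z'} hZ hZ' := by
    have e1 := mvfderiv_fun_add (mdiff_inner g hY hZ) (mdiff_inner g hY hZ')
    have e2 := mvfderiv_fun_add (mdiff_inner g hX hZ) (mdiff_inner g hX hZ')
    simp only [koszul, Pi.add_apply, map_add, add_apply,
      mlieBracket_add_right hZ hZ', e1, e2]
    ring

theorem koszul_add {Y Y' X Z : Π x : M, TangentSpace I x} {x : M}
    (hY : MDiffAt (T% Y) x) (hY' : MDiffAt (T% Y') x)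
    (hX : MDiffAt (T% X) x) (hZ : MDiffAt (T% Z) x) :
    koszul g (Y + Y') X Z x = koszul g Y X Z x + koszul g Y' X Z x := by
  have e1 := mvfderiv_fun_add (mdiff_inner g hY hZ) (mdiff_inner g hY' hZ)
  have e2 := mvfderiv_fun_add (mdiff_inner g hX hY) (mdiff_inner g hX hY')
  simp only [koszul, Pi.add_apply, map_add, add_apply,
    mlieBracket_add_left hY hY', mlieBracket_add_right hY hY', e1, e2]
  ring

theorem koszul_smul {f : M → ℝ} {Y X Z : Π x : M, TangentSpace I x} {x : M}
    (hf : MDiffAt f x) (hY : MDiffAt (T% Y) x)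
    (hX : MDiffAt (T% X) x) (hZ : MDiffAt (T% Z) x) :
    koszul g (f • Y) X Z x
      = f x * koszul g Y X Z x + 2 * (mvfderiv I f x (X x) * g.inner x (Y x) (Z x)) := by
  have e1 := mvfderiv_fun_mul hf (mdiff_inner g hY hZ)
  have e2 := mvfderiv_fun_mul hf (mdiff_inner g hX hY)
  simp only [koszul, Pi.smul_apply', map_smul, mlieBracket_smul_left hf hY,
    mlieBracket_smul_right hf hY, map_add, add_apply, smul_apply, smul_eq_mul, e1, e2]
  simp
  rw [g.symm x (Y x) (X x)]
  ring

open Classical in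
/-- The underlying function of the Levi-Civita connection: `leviCivitaFun g Y x v` is `∇_v Y` at `x`,
the tangent vector with `2 g(∇_X Y, Z) = koszul g Y X Z` at `x`. As usual for derivatives,
it is given the value `0` at points where `Y` is not differentiable. -/
def leviCivitaFun (Y : Π x : M, TangentSpace I x) (x : M) :
    TangentSpace I x →L[ℝ] TangentSpace I x :=
  haveI : FiniteDimensional ℝ (TangentSpace I x) := inferInstanceAs (FiniteDimensional ℝ E)
  haveI : T2Space (TangentSpace I x) := inferInstanceAs (T2Space E)
  if hY : MDiffAt (T% Y) x then
    LinearMap.toContinuousLinearMap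
      ((1 / 2 : ℝ) • (flat g x).symm.toLinearMap ∘ₗ
        (TensorialAt.mkHom₂ (I := I) (F := E) (F' := E) (fun X Z ↦ koszul g Y X Z x) x
          (fun _ hZ ↦ koszul_tensorial_left g hY hZ)
          (fun _ hX ↦ koszul_tensorial_right g hY hX)).toLinearMap)
  else 0

theorem inner_leviCivitaFun {Y X Z : Π x : M, TangentSpace I x} {x : M}
    (hY : MDiffAt (T% Y) x) (hX : MDiffAt (T% X) x) (hZ : MDiffAt (T% Z) x) :
    g.inner x (leviCivitaFun g Y x (X x)) (Z x) = 1 / 2 * koszul g Y X Z x := by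
  have h := TensorialAt.mkHom₂_apply (I := I) (F := E) (F' := E)
    (Φ := fun X Z ↦ koszul g Y X Z x)
    (fun _ hZ ↦ koszul_tensorial_left g hY hZ) (fun _ hX ↦ koszul_tensorial_right g hY hX) hX hZ
  rw [← h, ← flat_apply]
  simp [leviCivitaFun, hY]

theorem clm_ext {x : M} {A B : TangentSpace I x →L[ℝ] TangentSpace I x}
    (h : ∀ X Z : Π x : M, TangentSpace I x, MDiffAt (T% X) x → MDiffAt (T% Z) x →
      g.inner x (A (X x)) (Z x) = g.inner x (B (X x)) (Z x)) : A = B := by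
  ext v
  apply flat_injective g x
  ext w
  simpa using h (FiberBundle.extend E v) (FiberBundle.extend E w)
    (FiberBundle.mdifferentiableAt_extend ..) (FiberBundle.mdifferentiableAt_extend ..)

/-- The Levi-Civita (Riemannian) connection of `g`: `leviCivita g Y x v` is `∇_v Y` at `x`. It is
compatible with `g` and torsion-free, see the two theorems below. -/
def leviCivita : CovariantDerivative I E (fun x : M ↦ TangentSpace I x) where
  toFun := leviCivitaFun g
  isCovariantDerivativeOnUniv :=
    { add := by
        intro σ σ' x hσ hσ' _
        apply clm_ext g
        intro X Z hX hZ
        rw [inner_leviCivitaFun g (mdifferentiableAt_add_section hσ hσ') hX hZ, koszul_add g hσ hσ' hX hZ]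
        simp only [add_apply, map_add]
        rw [inner_leviCivitaFun g hσ hX hZ, inner_leviCivitaFun g hσ' hX hZ]
        ring
      leibniz := by
        intro σ f x hσ hf _
        apply clm_ext g
        intro X Z hX hZ
        rw [inner_leviCivitaFun g (hf.smul_section hσ) hX hZ, koszul_smul g hf hσ hX hZ]
        simp only [add_apply, map_add, smul_apply, map_smul, ContinuousLinearMap.smulRight_apply,
          smul_eq_mul]
        rw [inner_leviCivitaFun g hσ hX hZ]
        ring }

theorem leviCivita_metric {X Y Z : Π x : M, TangentSpace I x} {x : M}
    (hX : MDiffAt (T% X) x) (hY : MDiffAt (T% Y) x) (hZ : MDiffAt (T% Z) x) :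
    mvfderiv I (fun y ↦ g.inner y (Y y) (Z y)) x (X x)
      = g.inner x (leviCivita g Y x (X x)) (Z x) + g.inner x (Y x) (leviCivita g Z x (X x)) := by
  rw [g.symm x (Y x)]
  change _ = g.inner x (leviCivitaFun g Y x (X x)) (Z x)
    + g.inner x (leviCivitaFun g Z x (X x)) (Y x)
  rw [inner_leviCivitaFun g hY hX hZ, inner_leviCivitaFun g hZ hX hY]
  have e : (fun y ↦ g.inner y (Z y) (Y y)) = fun y ↦ g.inner y (Y y) (Z y) :=
    funext fun y ↦ g.symm y _ _
  simp only [koszul, e]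
  rw [mlieBracket_swap_apply (V := Z) (W := Y)]
  simp
  ring

theorem leviCivita_torsion : (leviCivita g).torsion = 0 := by
  rw [CovariantDerivative.torsion_eq_zero_iff]
  intro X Y x hX hY
  apply flat_injective g x
  ext w
  obtain ⟨Z, hZ, rfl⟩ : ∃ Z : Π x : M, TangentSpace I x, MDiffAt (T% Z) x ∧ Z x = w :=
    ⟨FiberBundle.extend E w, FiberBundle.mdifferentiableAt_extend .., by simp⟩
  simp only [map_sub, sub_apply]
  change g.inner x (leviCivitaFun g Y x (X x)) (Z x)
    - g.inner x (leviCivitaFun g X x (Y x)) (Z x) = _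
  rw [inner_leviCivitaFun g hY hX hZ, inner_leviCivitaFun g hX hY hZ]
  have e : (fun y ↦ g.inner y (Y y) (X y)) = fun y ↦ g.inner y (X y) (Y y) :=
    funext fun y ↦ g.symm y _ _
  simp only [koszul, e]
  rw [mlieBracket_swap_apply (V := Y) (W := X)]
  simp
  ring

/-- `u` is a concircular vector field on `(M, g)` with potential function `f`: both are smooth and
`∇_X u = f X` for all `X`. -/
structure IsConcircular (u : Π x : M, TangentSpace I x) (f : M → ℝ) : Prop where
  smooth_field : ContMDiff I (I.prod 𝓘(ℝ, E)) ∞ (fun x ↦ (⟨x, u x⟩ : TangentBundle I M))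
  smooth_potential : ContMDiff I 𝓘(ℝ, ℝ) ∞ f
  conn_eq : ∀ (x : M) (X : TangentSpace I x), leviCivita g u x X = f x • X

/-- A concircular vector field is non-trivial if its potential function is not identically zero. -/
structure IsNontrivialConcircular (u : Π x : M, TangentSpace I x) (f : M → ℝ) : Prop
    extends IsConcircular g u f where
  potential_ne_zero : f ≠ 0

/-- `ρ` is a connecting function of the concircular field `u` with potential function `f`: it is
smooth and `∇f = ρ u`. -/
structure IsConnectingFunction (u : Π x : M, TangentSpace I x) (f ρ : M → ℝ) : Prop where
  smooth : ContMDiff I 𝓘(ℝ, ℝ) ∞ ρ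
  gradient_eq : ∀ x : M, gradient g f x = ρ x • u x

end RiemGeom

end

/-!
The flow `φ` of `u` has a simple global structure. Along a flow line `f' = ρ |u|²`, because
`∇f = ρ u`, and `(|u|²)' = 2 f |u|²`, because `∇_u u = f u`. The function `ρ` has constant sign, so
`f` is strictly monotone along every nonconstant flow line. Its maximum and minimum are attained at
zeros of `u`, hence exactly at the two zeros, and every other flow line runs from one of them, `p`,
to the other, `q`, uniformly on compact sets (`IsGradientLike.exists_forall_mem_nhds`). On such a
flow line `|u|²` tends to zero at both ends; by its logarithmic derivative `2 f` this
excludes `ρ > 0` and forces `f q < 0` at the sink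
(`RiemGeom.IsConcircular.exists_isGradientLike_potential`).

At a zero `∇_X u = [X, u]`, so in a chart at `q` the derivative of `u` is `f q` times the identity
(`RiemGeom.IsConcircular.fderiv_chartField`). Therefore `u` points inwards along all small
coordinate spheres about `q`, and such a sphere meets every flow line other than `p` and `q` exactly once
(`IsGradientLike.isSphereSection`). Polar coordinates along the flow (`flowPolar`), in which the ray
through a point of the sphere follows its flow line from `q` to `p`, give a continuous bijection
from the one-point compactification of `ℝⁿ` onto the compact Hausdorff space `M`; it is a homeomorphism,
and the one-point compactification of `ℝⁿ` is `Sⁿ`.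

The flow itself is built from the Picard–Lindelöf theorem (`exists_flow_isMIntegralCurve`).
-/

open Set Filter Topology

/-! ### The flow of a vector field on a compact manifold -/

section ManifoldFlow

variable {E : Type*} [NormedAddCommGroup E] [NormedSpace ℝ E]
  {H : Type*} [TopologicalSpace H] {I : ModelWithCorners ℝ E H}
  {M : Type*} [TopologicalSpace M] [ChartedSpace H M] [IsManifold I 1 M]

variable (I) in
/-- The vector field `v` read in the preferred chart at `x₀`, as a map of the model space. -/
noncomputable def chartField (v : Π x : M, TangentSpace I x) (x₀ : M) (y : E) : E :=
  tangentCoordChange I ((extChartAt I x₀).symm y) x₀ ((extChartAt I x₀).symm y)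
    (v ((extChartAt I x₀).symm y))

theorem contDiffAt_chartField [BoundarylessManifold I M] {v : Π x : M, TangentSpace I x} {x₀ : M}
    (hv : CMDiffAt 1 (fun x ↦ (⟨x, v x⟩ : TangentBundle I M)) x₀) :
    ContDiffAt ℝ 1 (chartField I v x₀) (extChartAt I x₀ x₀) := by
  rw [contMDiffAt_iff] at hv
  exact (hv.2.contDiffAt
    (range_mem_nhds_isInteriorPoint BoundarylessManifold.isInteriorPoint)).snd

/-- A solution of the differential equation of `chartField` is, read back in `M`, tangent to `v`. -/
theorem hasMFDerivAt_chart_symm_comp {v : Π x : M, TangentSpace I x} {x₀ : M} {c : ℝ → E} {t : ℝ}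
    (hc : HasDerivAt c (chartField I v x₀ (c t)) t)
    (ht : c t ∈ interior (extChartAt I x₀).target) :
    HasMFDerivAt 𝓘(ℝ, ℝ) I ((extChartAt I x₀).symm ∘ c) t
      ((1 : ℝ →L[ℝ] ℝ).smulRight (v (((extChartAt I x₀).symm ∘ c) t))) := by
  let xₜ : M := (extChartAt I x₀).symm (c t)
  let w : E := v xₜ
  have h : HasDerivAt c (tangentCoordChange I xₜ x₀ xₜ w) t := hc
  have ht' := interior_subset ht
  have hsrc : xₜ ∈ (extChartAt I x₀).source := (extChartAt I x₀).map_target ht'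
  have hsrc' := mem_extChartAt_source (I := I) xₜ
  -- the derivative in the preferred chart at the current point
  have key : HasDerivAt ((extChartAt I xₜ ∘ (extChartAt I x₀).symm) ∘ c) w t := by
    rw [← tangentCoordChange_self (I := I) (x := xₜ) (z := xₜ) (v := w) hsrc',
      ← tangentCoordChange_comp (x := x₀) ⟨⟨hsrc', hsrc⟩, hsrc'⟩]
    apply HasFDerivAt.comp_hasDerivAt _ _ h
    apply HasFDerivWithinAt.hasFDerivAt (s := range I) _ <|
      mem_nhds_iff.mpr ⟨interior (extChartAt I x₀).target,
        subset_trans interior_subset (extChartAt_target_subset_range ..),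
        isOpen_interior, ht⟩
    rw [← (extChartAt I x₀).right_inv ht']
    exact hasFDerivWithinAt_tangentCoordChange ⟨hsrc, hsrc'⟩
  have key' : HasFDerivAt ((extChartAt I xₜ ∘ (extChartAt I x₀).symm) ∘ c)
      ((1 : ℝ →L[ℝ] ℝ).smulRight w) t :=
    key.hasFDerivAt.congr_fderiv (by ext; simp)
  exact ⟨(continuousAt_extChartAt_symm'' ht').comp h.continuousAt, key'.hasFDerivWithinAt⟩

/-- Conversely, an integral curve of `v` solves the differential equation of `chartField` in any
preferred chart, not only in the one at its starting point. -/
theorem IsMIntegralCurve.hasDerivAt_extChartAt_comp {v : Π x : M, TangentSpace I x} {x₀ : M}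
    {γ : ℝ → M} (hγ : IsMIntegralCurve γ v) {t : ℝ} (ht : γ t ∈ (extChartAt I x₀).source) :
    HasDerivAt (fun s ↦ extChartAt I x₀ (γ s)) (chartField I v x₀ (extChartAt I x₀ (γ t))) t := by
  have hsrc := extChartAt_source I x₀ ▸ ht
  rw [chartField, (extChartAt I x₀).left_inv ht]
  have h : HasMFDerivAt 𝓘(ℝ, ℝ) 𝓘(ℝ, E) (extChartAt I x₀ ∘ γ) t _ :=
    (hasMFDerivAt_extChartAt (I := I) hsrc).comp t (hγ t)
  rw [mfderiv_chartAt_eq_tangentCoordChange hsrc] at h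
  have h' : HasFDerivAt (extChartAt I x₀ ∘ γ)
      ((tangentCoordChange I (γ t) x₀ (γ t)).comp ((1 : ℝ →L[ℝ] ℝ).smulRight (v (γ t) : E))) t :=
    h.hasFDerivAt
  have happ : ∀ (L : E →L[ℝ] E) (w : E), L.comp ((1 : ℝ →L[ℝ] ℝ).smulRight w) 1 = L w := by simp
  exact h'.hasDerivAt.congr_deriv (happ _ (v (γ t)))

theorem chartField_eq_zero {v : Π x : M, TangentSpace I x} {x₀ : M} (h : v x₀ = 0) :
    chartField I v x₀ (extChartAt I x₀ x₀) = 0 := by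
  have h' : v ((extChartAt I x₀).symm (extChartAt I x₀ x₀)) = 0 := by rw [extChartAt_to_inv, h]
  rw [chartField, h']
  exact map_zero (tangentCoordChange I _ x₀ _)

theorem mpullbackWithin_extChartAt_symm_eq_chartField
    (u : Π x : M, TangentSpace I x) (x₀ : M) {y : E} (hy : y ∈ (extChartAt I x₀).target) :
    mpullbackWithin 𝓘(ℝ, E) I (extChartAt I x₀).symm u (range I) y = chartField I u x₀ y := by
  have hs : (extChartAt I x₀).symm y ∈ (chartAt H x₀).source :=
    extChartAt_source I x₀ ▸ (extChartAt I x₀).map_target hy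
  have h1 : mfderiv I 𝓘(ℝ, E) (extChartAt I x₀) ((extChartAt I x₀).symm y) =
      tangentCoordChange I ((extChartAt I x₀).symm y) x₀ ((extChartAt I x₀).symm y) := by
    rw [(hasMFDerivAt_extChartAt hs).mfderiv, mfderiv_chartAt_eq_tangentCoordChange hs]
  rw [mpullbackWithin_apply, ContinuousLinearMap.inverse_eq
    (mfderivWithin_extChartAt_symm_comp_mfderiv_extChartAt hy)
    (mfderiv_extChartAt_comp_mfderivWithin_extChartAt_symm hy), h1]
  rfl

/-- A `C¹` vector field has a continuous local flow near every point. -/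
theorem exists_local_flow [CompleteSpace E] [BoundarylessManifold I M]
    {v : Π x : M, TangentSpace I x} (x₀ : M)
    (hv : CMDiffAt 1 (fun x ↦ (⟨x, v x⟩ : TangentBundle I M)) x₀) :
    ∃ ε > 0, ∃ U ∈ 𝓝 x₀, ∃ α : M → ℝ → M,
      (∀ x ∈ U, α x 0 = x ∧ IsMIntegralCurveOn (α x) v (Ioo (-ε) ε)) ∧
      ContinuousOn (fun z : ℝ × M ↦ α z.2 z.1) (Ioo (-ε) ε ×ˢ U) := by
  set e := extChartAt I x₀
  obtain ⟨δ, hδ, a, r, L, K, hr, hpl⟩ :=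
    IsPicardLindelof.of_contDiffAt_one (contDiffAt_chartField hv)
  obtain ⟨β, hβ, hβc⟩ := (hpl 0).exists_forall_mem_closedBall_eq_hasDerivWithinAt_continuousOn
  have hx₀ : e x₀ ∈ interior e.target :=
    (I.isInteriorPoint_iff).mp BoundarylessManifold.isInteriorPoint
  have hr' : (0 : ℝ) < r := hr
  have hβ0 : β (e x₀, 0) = e x₀ := (hβ _ (Metric.mem_closedBall_self hr'.le)).1
  have hnhds : Metric.closedBall (e x₀) r ×ˢ Icc (0 - δ) (0 + δ) ∈ 𝓝 (e x₀, (0 : ℝ)) :=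
    prod_mem_nhds (Metric.closedBall_mem_nhds _ hr') (Icc_mem_nhds (by linarith) (by linarith))
  have hpre : ∀ᶠ z in 𝓝 (e x₀, (0 : ℝ)), β z ∈ interior e.target := by
    refine (hβc.continuousAt hnhds).eventually_mem ?_
    rw [hβ0]
    exact isOpen_interior.mem_nhds hx₀
  obtain ⟨V, hV, W, hW, hVW⟩ := mem_nhds_prod_iff.1 (hpre.and hnhds)
  obtain ⟨ε, hε, hεW⟩ := Metric.mem_nhds_iff.1 hW
  rw [Real.ball_eq_Ioo, zero_sub, zero_add] at hεW
  refine ⟨ε, hε, e.source ∩ e ⁻¹' V, inter_mem (extChartAt_source_mem_nhds x₀)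
    ((continuousAt_extChartAt x₀).preimage_mem_nhds hV), fun x t ↦ e.symm (β (e x, t)), ?_, ?_⟩
  · rintro x ⟨hxs, hxV⟩
    have hV0 := (hVW (⟨hxV, mem_of_mem_nhds hW⟩ : (e x, (0 : ℝ)) ∈ V ×ˢ W)).2
    obtain ⟨h0, h1⟩ := hβ _ hV0.1
    refine ⟨by simp only [h0, e.left_inv hxs], fun t ht ↦ HasMFDerivAt.hasMFDerivWithinAt ?_⟩
    obtain ⟨h2, h3⟩ := hVW (⟨hxV, hεW ht⟩ : (e x, t) ∈ V ×ˢ W)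
    refine hasMFDerivAt_chart_symm_comp (c := fun s ↦ β (e x, s)) ?_ h2
    refine (h1 t h3.2).hasDerivAt ?_
    filter_upwards [isOpen_Ioo.mem_nhds ht] with s hs
    exact (hVW (⟨hxV, hεW hs⟩ : (e x, s) ∈ V ×ˢ W)).2.2
  · rintro ⟨t, x⟩ ⟨ht, hxs, hxV⟩
    have h1 := hVW (⟨hxV, hεW ht⟩ : (e x, t) ∈ V ×ˢ W)
    have hβt : ContinuousWithinAt (fun z : ℝ × M ↦ β (e z.2, z.1))
        (Ioo (-ε) ε ×ˢ (e.source ∩ e ⁻¹' V)) (t, x) := by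
      refine ContinuousWithinAt.comp (t := Metric.closedBall (e x₀) r ×ˢ Icc (0 - δ) (0 + δ))
        (hβc _ h1.2) ?_ ?_
      · refine ContinuousAt.continuousWithinAt ?_
        exact ((continuousAt_extChartAt' hxs).comp continuousAt_snd).prodMk continuousAt_fst
      · rintro ⟨s, y⟩ ⟨hs, hys, hyV⟩
        exact (hVW (⟨hyV, hεW hs⟩ : (e y, s) ∈ V ×ˢ W)).2
    exact ContinuousAt.comp_continuousWithinAt (f := fun z : ℝ × M ↦ β (e z.2, z.1)) (g := e.symm)
      (continuousAt_extChartAt_symm'' (interior_subset h1.1)) hβt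

variable [T2Space M] [CompactSpace M]

/-- A `C¹` vector field on a compact manifold without boundary is complete, and its integral curves
form a continuous flow. -/
theorem exists_flow_isMIntegralCurve [CompleteSpace E] [BoundarylessManifold I M]
    {v : Π x : M, TangentSpace I x}
    (hv : CMDiff 1 (fun x ↦ (⟨x, v x⟩ : TangentBundle I M))) :
    ∃ φ : Flow ℝ M, ∀ x, IsMIntegralCurve (fun t ↦ φ t x) v := by
  -- a uniform existence time, from a finite cover by domains of local flows
  obtain ⟨ε, hε, hloc⟩ : ∃ ε > 0, ∀ x₀ : M, ∃ U ∈ 𝓝 x₀, ∃ α : M → ℝ → M,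
      (∀ x ∈ U, α x 0 = x ∧ IsMIntegralCurveOn (α x) v (Ioo (-ε) ε)) ∧
      ContinuousOn (fun z : ℝ × M ↦ α z.2 z.1) (Ioo (-ε) ε ×ˢ U) := by
    choose ε hε U hU α hα hαc using fun x₀ : M ↦ exists_local_flow (I := I) x₀ (hv x₀)
    obtain ⟨s, hs⟩ := CompactSpace.elim_nhds_subcover (fun x ↦ interior (U x))
      fun x ↦ interior_mem_nhds.2 (hU x)
    obtain ⟨δ, hδ, hδs⟩ : ∃ δ > 0, ∀ x ∈ s, δ ≤ ε x := by
      rcases s.eq_empty_or_nonempty with rfl | hne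
      · exact ⟨1, one_pos, by simp⟩
      · obtain ⟨m, hm, hmin⟩ := s.exists_min_image ε hne
        exact ⟨ε m, hε m, hmin⟩
    refine ⟨δ, hδ, fun x₀ ↦ ?_⟩
    obtain ⟨y, hy, hyx⟩ : ∃ y ∈ s, x₀ ∈ interior (U y) := by
      have : x₀ ∈ ⋃ x ∈ s, interior (U x) := hs ▸ mem_univ x₀
      simpa using this
    have hsub : Ioo (-δ) δ ⊆ Ioo (-(ε y)) (ε y) :=
      Ioo_subset_Ioo (neg_le_neg (hδs y hy)) (hδs y hy)
    exact ⟨U y, mem_interior_iff_mem_nhds.1 hyx, α y,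
      fun x hx ↦ ⟨(hα y x hx).1, (hα y x hx).2.mono hsub⟩,
      (hαc y).mono (prod_mono hsub subset_rfl)⟩
  have hex : ∀ x : M, ∃ γ : ℝ → M, γ 0 = x ∧ IsMIntegralCurve γ v := by
    refine exists_isMIntegralCurve_of_isMIntegralCurveOn hv hε fun x ↦ ?_
    obtain ⟨U, hU, α, hα, -⟩ := hloc x
    exact ⟨α x, hα x (mem_of_mem_nhds hU)⟩
  choose Φ hΦ0 hΦ using hex
  -- the group law is uniqueness of integral curves; with it, continuity at short times
  -- spreads to all times
  have hadd : ∀ s t x, Φ x (s + t) = Φ (Φ x t) s := by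
    intro s t x
    have := isMIntegralCurve_Ioo_eq_of_contMDiff_boundaryless (t₀ := 0) hv ((hΦ x).comp_add t)
      (hΦ (Φ x t)) (by simp [hΦ0])
    exact congrFun this s
  have hshort : ∀ t ∈ Ioo (-ε) ε, ∀ x, ContinuousAt (fun z : ℝ × M ↦ Φ z.2 z.1) (t, x) := by
    intro t ht x
    obtain ⟨U, hU, α, hα, hαc⟩ := hloc x
    have hn : Ioo (-ε) ε ×ˢ U ∈ 𝓝 (t, x) := prod_mem_nhds (isOpen_Ioo.mem_nhds ht) hU
    refine (hαc.continuousAt hn).congr ?_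
    filter_upwards [hn] with z hz
    exact isMIntegralCurveOn_Ioo_eqOn_of_contMDiff_boundaryless
      (⟨neg_lt_zero.2 hε, hε⟩ : (0 : ℝ) ∈ Ioo (-ε) ε) hv (hα z.2 hz.2).2
      ((hΦ z.2).isMIntegralCurveOn _) (by rw [(hα z.2 hz.2).1, hΦ0]) hz.1
  have hshort' : ∀ t ∈ Ioo (-ε) ε, Continuous fun x ↦ Φ x t := fun t ht ↦
    continuous_iff_continuousAt.2 fun x ↦
      ContinuousAt.comp (x := x) (f := fun y : M ↦ (t, y)) (hshort t ht x) (by fun_prop)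
  have hiter : ∀ t ∈ Ioo (-ε) ε, ∀ k : ℕ, Continuous fun x ↦ Φ x (k * t) := by
    intro t ht k
    induction k with
    | zero => simpa [hΦ0] using continuous_id'
    | succ k ih =>
      have : (fun x ↦ Φ x ((k + 1 : ℕ) * t)) = fun x ↦ Φ (Φ x (k * t)) t := by
        ext x
        rw [← hadd]
        congr 1
        push_cast
        ring
      rw [this]
      exact (hshort' t ht).comp ih
  have hcont : ∀ t, Continuous fun x ↦ Φ x t := by
    intro t
    obtain ⟨k, hk⟩ := exists_nat_gt (|t| / ε)
    have hk0 : (0 : ℝ) < k := lt_of_le_of_lt (by positivity) hk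
    have := hiter (t / k) (by
      rw [mem_Ioo, ← abs_lt, abs_div, abs_of_pos hk0, div_lt_iff₀ hk0, mul_comm]
      exact (div_lt_iff₀ hε).1 hk) k
    simpa [mul_div_cancel₀ t hk0.ne'] using this
  refine ⟨⟨fun t x ↦ Φ x t, ?_, fun s t x ↦ hadd s t x, hΦ0⟩, hΦ⟩
  rw [continuous_iff_continuousAt]
  rintro ⟨t, x⟩
  have : (Function.uncurry fun t x ↦ Φ x t) =
      (fun z : ℝ × M ↦ Φ z.2 z.1) ∘ fun z : ℝ × M ↦ (z.1 - t, Φ z.2 t) := by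
    ext ⟨s, y⟩
    simp [Function.uncurry, ← hadd]
  rw [this]
  refine ContinuousAt.comp (hshort _ ?_ _) ?_
  · simpa using hε
  · have := hcont t
    fun_prop

end ManifoldFlow

/-! ### Gradient-like flows with two rest points -/

section GradientLike

variable {M : Type*} [TopologicalSpace M]

/-- The time reversal of a flow. -/
def Flow.timeReversal (φ : Flow ℝ M) : Flow ℝ M where
  toFun t := φ (-t)
  cont' := φ.continuous continuous_fst.neg continuous_snd
  map_add' s t x := by rw [neg_add, φ.map_add]
  map_zero' x := by rw [neg_zero, φ.map_zero_apply]

theorem Flow.timeReversal_apply (φ : Flow ℝ M) (t : ℝ) (x : M) :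
    φ.timeReversal t x = φ (-t) x := rfl

/-- Off its two rest points, the flow strictly decreases `F`, whose strict minimum is the rest
point `q` and whose strict maximum is the rest point `p`. -/
structure IsGradientLike (φ : Flow ℝ M) (F : M → ℝ) (p q : M) : Prop where
  continuous : Continuous F
  fixed_left : ∀ t, φ t p = p
  fixed_right : ∀ t, φ t q = q
  strictAnti : ∀ x, x ≠ p → x ≠ q → StrictAnti fun t ↦ F (φ t x)
  lt_left : ∀ x, x ≠ p → F x < F p
  right_lt : ∀ x, x ≠ q → F q < F x

namespace IsGradientLike

variable {φ : Flow ℝ M} {F : M → ℝ} {p q : M}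

theorem timeReversal (h : IsGradientLike φ F p q) :
    IsGradientLike φ.timeReversal (fun x ↦ -F x) q p where
  continuous := h.continuous.neg
  fixed_left _ := h.fixed_right _
  fixed_right _ := h.fixed_left _
  strictAnti x hq hp _ _ hst := neg_lt_neg (h.strictAnti x hp hq (neg_lt_neg hst))
  lt_left x hx := neg_lt_neg (h.right_lt x hx)
  right_lt x hx := neg_lt_neg (h.lt_left x hx)

theorem antitone (h : IsGradientLike φ F p q) (x : M) : Antitone fun t ↦ F (φ t x) := by
  by_cases hp : x = p
  · subst hp
    simpa only [h.fixed_left] using antitone_const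
  by_cases hq : x = q
  · subst hq
    simpa only [h.fixed_right] using antitone_const
  exact (h.strictAnti x hp hq).antitone

/-- No orbit other than `p` stays above a value larger than `F q`: along the orbit of a limit point
`F` is constant, so the limit point is a rest point, and it lies below `p`. -/
theorem exists_apply_lt [CompactSpace M] (h : IsGradientLike φ F p q) {x : M} (hx : x ≠ p)
    {c : ℝ} (hc : F q < c) :
    ∃ t, F (φ t x) < c := by
  by_contra! hcon
  have hbdd : BddBelow (range fun t ↦ F (φ t x)) := ⟨c, by rintro _ ⟨t, rfl⟩; exact hcon t⟩
  set L := ⨅ t, F (φ t x)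
  have hlim : Tendsto (fun t ↦ F (φ t x)) atTop (𝓝 L) := tendsto_atTop_ciInf (h.antitone x) hbdd
  -- `F` is constant along the orbit of a limit point `z`, so that `z` is a rest point
  obtain ⟨z, hz⟩ : ∃ z, MapClusterPt z atTop (fun t ↦ φ t x) := exists_clusterPt_of_compactSpace _
  have hconst : ∀ s, F (φ s z) = L := by
    intro s
    have h1 : MapClusterPt (F (φ s z)) atTop (fun t ↦ F (φ s (φ t x))) :=
      hz.continuousAt_comp (f := fun y ↦ F (φ s y))
        (h.continuous.comp (φ.continuous_toFun s)).continuousAt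
    have h2 : Tendsto (fun t ↦ F (φ s (φ t x))) atTop (𝓝 L) := by
      simp only [← φ.map_add]
      exact hlim.comp (tendsto_atTop_add_const_left atTop s tendsto_id)
    obtain ⟨u, hu, hu'⟩ := mapClusterPt_iff_ultrafilter.1 h1
    exact tendsto_nhds_unique hu' (h2.mono_left hu)
  have hz0 : F z = L := by simpa [φ.map_zero_apply] using hconst 0
  have hLc : c ≤ L := le_ciInf hcon
  have hLx : L ≤ F x := by simpa [φ.map_zero_apply] using ciInf_le hbdd 0
  have hzp : z ≠ p := by
    rintro rfl
    exact absurd (h.lt_left x hx) (not_lt.2 (hz0 ▸ hLx))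
  have hzq : z ≠ q := by
    rintro rfl
    exact absurd hc (not_lt.2 (hz0 ▸ hLc))
  have := h.strictAnti z hzp hzq zero_lt_one
  simp only [hconst, lt_irrefl] at this

/-- Every compact set avoiding the source is carried into any neighbourhood of the sink, and stays
there. This is Dini's argument: the open sets `{x | F (φ t x) < c}` increase with `t`. -/
theorem exists_forall_mem_nhds [CompactSpace M] (h : IsGradientLike φ F p q) {K : Set M}
    (hK : IsCompact K) (hp : p ∉ K) {U : Set M} (hU : U ∈ 𝓝 q) :
    ∃ T : ℝ, ∀ t, T ≤ t → ∀ x ∈ K, φ t x ∈ U := by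
  obtain ⟨c, hc, hcU⟩ : ∃ c, F q < c ∧ ∀ x, F x < c → x ∈ U := by
    have hcomp : IsCompact (interior U)ᶜ := isOpen_interior.isClosed_compl.isCompact
    rcases (interior U)ᶜ.eq_empty_or_nonempty with he | hne
    · refine ⟨F q + 1, by linarith, fun x _ ↦ interior_subset ?_⟩
      rw [compl_empty_iff] at he
      exact he ▸ mem_univ x
    · obtain ⟨m, hm, hmin⟩ := hcomp.exists_isMinOn hne h.continuous.continuousOn
      refine ⟨F m, h.right_lt m ?_, fun x hx ↦ interior_subset ?_⟩
      · rintro rfl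
        exact hm (mem_interior_iff_mem_nhds.2 hU)
      · by_contra hxU
        exact absurd hx (not_lt.2 (hmin hxU))
  obtain ⟨T, hT⟩ := hK.elim_directed_cover (fun t : ℝ ↦ {x | F (φ t x) < c})
    (fun t ↦ isOpen_lt (h.continuous.comp (φ.continuous_toFun t)) continuous_const)
    (fun x hx ↦ mem_iUnion.2 (h.exists_apply_lt (ne_of_mem_of_not_mem hx hp) hc))
    (Monotone.directed_le fun s t hst x hx ↦ (h.antitone x hst).trans_lt hx)
  exact ⟨T, fun t ht x hx ↦ hcU _ ((h.antitone x ht).trans_lt (hT hx))⟩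

theorem tendsto_atTop [CompactSpace M] (h : IsGradientLike φ F p q) {x : M} (hx : x ≠ p) :
    Tendsto (fun t ↦ φ t x) atTop (𝓝 q) := by
  intro U hU
  obtain ⟨T, hT⟩ := h.exists_forall_mem_nhds isCompact_singleton (notMem_singleton_iff.2 hx.symm) hU
  exact mem_atTop_sets.2 ⟨T, fun t ht ↦ hT t ht x rfl⟩

theorem tendsto_atBot [CompactSpace M] (h : IsGradientLike φ F p q) {x : M} (hx : x ≠ q) :
    Tendsto (fun t ↦ φ t x) atBot (𝓝 p) := by
  have := (h.timeReversal.tendsto_atTop hx).comp tendsto_neg_atBot_atTop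
  simpa [Function.comp_def, Flow.timeReversal_apply] using this

end IsGradientLike

/-- `σ` embeds the unit sphere of `E` as a cross-section of the flow: every orbit other than the
rest points `p` and `q` meets it exactly once. -/
structure IsSphereSection {E : Type*} [NormedAddCommGroup E] (φ : Flow ℝ M) (p q : M) (σ : E → M) :
    Prop where
  continuousOn : ContinuousOn σ (Metric.sphere 0 1)
  ne_left : ∀ θ ∈ Metric.sphere (0 : E) 1, σ θ ≠ p
  ne_right : ∀ θ ∈ Metric.sphere (0 : E) 1, σ θ ≠ q
  eq_of_apply_eq : ∀ θ ∈ Metric.sphere (0 : E) 1, ∀ θ' ∈ Metric.sphere (0 : E) 1, ∀ t,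
    φ t (σ θ) = σ θ' → t = 0 ∧ θ = θ'
  exists_apply_eq : ∀ x, x ≠ p → x ≠ q → ∃ θ ∈ Metric.sphere (0 : E) 1, ∃ t, φ t (σ θ) = x

open Classical in
/-- Polar coordinates along the flow: the ray through the unit vector `θ` runs along the orbit of
`σ θ`, from `q` at the origin to `p` at infinity. -/
noncomputable def flowPolar {E : Type*} [NormedAddCommGroup E] [NormedSpace ℝ E] (φ : Flow ℝ M)
    (p q : M) (σ : E → M) : OnePoint E → M :=
  fun z ↦ z.elim p fun y ↦ if y = 0 then q else φ (-Real.log ‖y‖) (σ (‖y‖⁻¹ • y))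

section flowPolar

variable {E : Type*} [NormedAddCommGroup E] [NormedSpace ℝ E]
  {φ : Flow ℝ M} {F : M → ℝ} {p q : M} {σ : E → M}

theorem inv_norm_smul_mem_sphere {y : E} (hy : y ≠ 0) : ‖y‖⁻¹ • y ∈ Metric.sphere (0 : E) 1 := by
  simp [norm_smul, hy]

theorem flowPolar_infty : flowPolar φ p q σ OnePoint.infty = p := rfl

theorem flowPolar_zero : flowPolar φ p q σ ((0 : E) : OnePoint E) = q := if_pos rfl

theorem flowPolar_coe {y : E} (hy : y ≠ 0) :
    flowPolar φ p q σ (y : OnePoint E) = φ (-Real.log ‖y‖) (σ (‖y‖⁻¹ • y)) := if_neg hy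

theorem flow_ne_of_fixed {r : M} (hr : ∀ t, φ t r = r) {x : M} (hx : x ≠ r) (t : ℝ) :
    φ t x ≠ r := by
  intro h
  apply hx
  rw [← hr (-t), ← h, ← φ.map_add, neg_add_cancel, φ.map_zero_apply]

theorem flowPolar_injective (h : IsGradientLike φ F p q) (hσ : IsSphereSection φ p q σ)
    (hpq : p ≠ q) : Function.Injective (flowPolar φ p q σ) := by
  have hp : ∀ y : E, flowPolar φ p q σ y ≠ p := by
    intro y
    by_cases hy : y = 0
    · subst hy
      rw [flowPolar_zero]
      exact hpq.symm
    · rw [flowPolar_coe hy]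
      exact flow_ne_of_fixed h.fixed_left (hσ.ne_left _ (inv_norm_smul_mem_sphere hy)) _
  have hq : ∀ y : E, y ≠ 0 → flowPolar φ p q σ y ≠ q := by
    intro y hy
    rw [flowPolar_coe hy]
    exact flow_ne_of_fixed h.fixed_right (hσ.ne_right _ (inv_norm_smul_mem_sphere hy)) _
  intro z z' hzz
  induction z using OnePoint.rec with
  | infty =>
    induction z' using OnePoint.rec with
    | infty => rfl
    | coe y' => exact absurd hzz.symm (hp y')
  | coe y =>
    induction z' using OnePoint.rec with
    | infty => exact absurd hzz (hp y)
    | coe y' =>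
      by_cases hy : y = 0
      · by_cases hy' : y' = 0
        · rw [hy, hy']
        · subst hy
          exact absurd (hzz.symm.trans flowPolar_zero) (hq y' hy')
      · by_cases hy' : y' = 0
        · subst hy'
          exact absurd (hzz.trans flowPolar_zero) (hq y hy)
        · rw [flowPolar_coe hy, flowPolar_coe hy'] at hzz
          have h1 := congrArg (φ (Real.log ‖y'‖)) hzz
          rw [← φ.map_add, ← φ.map_add, add_neg_cancel, φ.map_zero_apply] at h1
          obtain ⟨h2, h3⟩ := hσ.eq_of_apply_eq _ (inv_norm_smul_mem_sphere hy) _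
            (inv_norm_smul_mem_sphere hy') _ h1
          have h4 : ‖y‖ = ‖y'‖ :=
            Real.log_injOn_pos (norm_pos_iff.2 hy) (norm_pos_iff.2 hy') (by linarith)
          rw [h4] at h3
          rw [smul_right_injective E (inv_ne_zero (norm_ne_zero_iff.2 hy')) h3]

theorem flowPolar_surjective (hσ : IsSphereSection φ p q σ) :
    Function.Surjective (flowPolar φ p q σ) := by
  intro x
  by_cases hp : x = p
  · exact ⟨OnePoint.infty, hp.symm⟩
  by_cases hq : x = q
  · exact ⟨((0 : E) : OnePoint E), by rw [flowPolar_zero, hq]⟩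
  obtain ⟨θ, hθ, t, rfl⟩ := hσ.exists_apply_eq x hp hq
  have hθ1 : ‖θ‖ = 1 := by simpa using hθ
  have hθ0 : θ ≠ 0 := by
    rintro rfl
    simp at hθ1
  have hn : ‖Real.exp (-t) • θ‖ = Real.exp (-t) := by
    rw [norm_smul, hθ1, mul_one, Real.norm_eq_abs, abs_of_pos (Real.exp_pos _)]
  refine ⟨((Real.exp (-t) • θ : E) : OnePoint E), ?_⟩
  rw [flowPolar_coe (smul_ne_zero (Real.exp_pos _).ne' hθ0), hn, Real.log_exp, neg_neg,
    inv_smul_smul₀ (Real.exp_pos _).ne']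

theorem flowPolar_continuous [FiniteDimensional ℝ E] [CompactSpace M]
    (h : IsGradientLike φ F p q) (hσ : IsSphereSection φ p q σ) :
    Continuous (flowPolar φ p q σ) := by
  have hK : IsCompact (σ '' Metric.sphere 0 1) := (isCompact_sphere 0 1).image_of_continuousOn
    hσ.continuousOn
  have hpK : p ∉ σ '' Metric.sphere 0 1 := by
    rintro ⟨θ, hθ, h'⟩
    exact hσ.ne_left θ hθ h'
  have hqK : q ∉ σ '' Metric.sphere 0 1 := by
    rintro ⟨θ, hθ, h'⟩
    exact hσ.ne_right θ hθ h'
  have hmem : ∀ y : E, y ≠ 0 → σ (‖y‖⁻¹ • y) ∈ σ '' Metric.sphere 0 1 := fun y hy ↦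
    mem_image_of_mem _ (inv_norm_smul_mem_sphere hy)
  rw [continuous_iff_continuousAt]
  intro z
  induction z using OnePoint.rec with
  | infty =>
    rw [OnePoint.continuousAt_infty', coclosedCompact_eq_cocompact]
    intro U hU
    rw [flowPolar_infty] at hU
    obtain ⟨T, hT⟩ := h.timeReversal.exists_forall_mem_nhds hK hqK hU
    have h1 : ∀ᶠ y : E in cocompact E, T ≤ Real.log ‖y‖ :=
      (Real.tendsto_log_atTop.comp tendsto_norm_cocompact_atTop).eventually_ge_atTop T
    have h2 : ∀ᶠ y : E in cocompact E, 1 ≤ ‖y‖ :=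
      tendsto_norm_cocompact_atTop.eventually_ge_atTop 1
    rw [mem_map]
    filter_upwards [h1, h2] with y hy hy1
    have hy0 : y ≠ 0 := norm_pos_iff.1 (zero_lt_one.trans_le hy1)
    simp only [mem_preimage, Function.comp_apply]
    rw [flowPolar_coe hy0]
    exact hT _ hy _ (hmem y hy0)
  | coe y₀ =>
    rw [OnePoint.continuousAt_coe]
    by_cases hy₀ : y₀ = 0
    · subst hy₀
      intro U hU
      rw [Function.comp_apply, flowPolar_zero] at hU
      obtain ⟨T, hT⟩ := h.exists_forall_mem_nhds hK hpK hU
      have h1 : ∀ᶠ y : E in 𝓝 0, ‖y‖ < Real.exp (-T) := by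
        refine (continuous_norm.tendsto (0 : E)).eventually_lt_const ?_
        rw [norm_zero]
        exact Real.exp_pos _
      rw [mem_map]
      filter_upwards [h1] with y hy
      simp only [mem_preimage, Function.comp_apply]
      by_cases hy0 : y = 0
      · subst hy0
        rw [flowPolar_zero]
        exact mem_of_mem_nhds hU
      · rw [flowPolar_coe hy0]
        have := (Real.log_lt_iff_lt_exp (norm_pos_iff.2 hy0)).2 hy
        exact hT _ (by linarith) _ (hmem y hy0)
    · have hev : (flowPolar φ p q σ ∘ fun y : E ↦ (y : OnePoint E)) =ᶠ[𝓝 y₀]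
          fun y ↦ φ (-Real.log ‖y‖) (σ (‖y‖⁻¹ • y)) := by
        filter_upwards [isOpen_ne.mem_nhds hy₀] with y hy using flowPolar_coe hy
      refine ContinuousAt.congr ?_ hev.symm
      have hn : ‖y₀‖ ≠ 0 := norm_ne_zero_iff.2 hy₀
      have h1 : ContinuousAt (fun y : E ↦ -Real.log ‖y‖) y₀ :=
        (continuous_norm.continuousAt.log hn).neg
      have h2 : ContinuousOn (fun y : E ↦ σ (‖y‖⁻¹ • y)) {0}ᶜ := by
        refine hσ.continuousOn.comp ?_ fun y hy ↦ inv_norm_smul_mem_sphere hy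
        intro y hy
        exact ((continuous_norm.continuousAt.inv₀ (norm_ne_zero_iff.2 hy)).smul
          continuousAt_id).continuousWithinAt
      have h3 := h2.continuousAt (isOpen_compl_singleton.mem_nhds hy₀)
      exact ContinuousAt.comp (g := Function.uncurry φ.toFun)
        (f := fun y : E ↦ (-Real.log ‖y‖, σ (‖y‖⁻¹ • y))) φ.cont'.continuousAt (h1.prodMk h3)

theorem nonempty_onePoint_homeomorph [FiniteDimensional ℝ E] [CompactSpace M] [T2Space M]
    (h : IsGradientLike φ F p q) (hσ : IsSphereSection φ p q σ) (hpq : p ≠ q) :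
    Nonempty (OnePoint E ≃ₜ M) :=
  ⟨(flowPolar_continuous h hσ).homeoOfEquivCompactToT2
    (f := Equiv.ofBijective _ ⟨flowPolar_injective h hσ hpq, flowPolar_surjective hσ⟩)⟩

end flowPolar

end GradientLike

/-! ### Coordinate spheres as cross-sections -/

theorem HasDerivAt.eventually_lt_of_neg {f : ℝ → ℝ} {f' a : ℝ} (h : HasDerivAt f f' a)
    (hf : f' < 0) : (∀ᶠ x in 𝓝[>] a, f x < f a) ∧ ∀ᶠ x in 𝓝[<] a, f a < f x := by
  have hs := (h.tendsto_slope).eventually_lt_const hf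
  constructor
  · filter_upwards [hs.filter_mono (nhdsWithin_mono _ fun x (hx : a < x) ↦ hx.ne'),
      self_mem_nhdsWithin] with x hx hax
    have hax : 0 < x - a := sub_pos.2 hax
    rw [slope_def_field, div_lt_iff₀ hax] at hx
    linarith
  · filter_upwards [hs.filter_mono (nhdsWithin_mono _ fun x (hx : x < a) ↦ hx.ne),
      self_mem_nhdsWithin] with x hx hax
    have hax : x - a < 0 := sub_neg.2 hax
    rw [slope_def_field, div_lt_iff_of_neg hax] at hx
    linarith

section SphereSection

variable {M : Type*} [TopologicalSpace M] {E : Type*} [NormedAddCommGroup E]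
  {φ : Flow ℝ M} {p q : M} {e : OpenPartialHomeomorph M E} {W : E → E} {c : E} {r : ℝ}

theorem isOpen_symm_image_ball (hball : Metric.closedBall c r ⊆ e.target) :
    IsOpen (e.symm '' Metric.ball c r) :=
  e.symm.isOpen_image_of_subset_source Metric.isOpen_ball
    (Metric.ball_subset_closedBall.trans hball)

variable [InnerProductSpace ℝ E]

theorem hasDerivAt_norm_sub_sq
    (hW : ∀ x t, φ t x ∈ e.source → HasDerivAt (fun s ↦ e (φ s x)) (W (e (φ t x))) t)
    {x : M} {t : ℝ} (hx : φ t x ∈ e.source) :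
    HasDerivAt (fun s ↦ ‖e (φ s x) - c‖ ^ 2)
      (2 * inner ℝ (e (φ t x) - c) (W (e (φ t x)))) t :=
  ((hW x t hx).sub_const c).norm_sq

/-- If the vector field points inwards along a coordinate sphere, an orbit starting on that sphere
stays in the open coordinate ball at all later times. -/
theorem flow_mem_symm_image_ball [FiniteDimensional ℝ E] [T2Space M]
    (hball : Metric.closedBall c r ⊆ e.target)
    (hW : ∀ x t, φ t x ∈ e.source → HasDerivAt (fun s ↦ e (φ s x)) (W (e (φ t x))) t)
    (hneg : ∀ y ∈ Metric.sphere c r, inner ℝ (y - c) (W y) < 0)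
    {y : E} (hy : y ∈ Metric.sphere c r) {t : ℝ} (ht : 0 < t) :
    φ t (e.symm y) ∈ e.symm '' Metric.ball c r := by
  set x := e.symm y with hx
  set B := e.symm '' Metric.ball c r with hB
  have hBo : IsOpen B := isOpen_symm_image_ball hball
  have hKc : IsClosed (e.symm '' Metric.closedBall c r) :=
    ((isCompact_closedBall c r).image_of_continuousOn
      (e.continuousOn_symm.mono hball)).isClosed
  have hr : 0 ≤ r := Metric.nonneg_of_mem_sphere hy
  have hyt : y ∈ e.target := hball (Metric.sphere_subset_closedBall hy)
  have hcont : Continuous fun s ↦ φ s x := φ.continuous continuous_id continuous_const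
  have hBlt : ∀ z ∈ B, ‖e z - c‖ ^ 2 < r ^ 2 := by
    rintro _ ⟨w, hw, rfl⟩
    rw [e.right_inv (hball (Metric.ball_subset_closedBall hw))]
    have := mem_ball_iff_norm.1 hw
    gcongr
  have hltB : ∀ z ∈ e.source, ‖e z - c‖ ^ 2 < r ^ 2 → z ∈ B := by
    intro z hz hlt
    exact ⟨e z, mem_ball_iff_norm.2 (lt_of_pow_lt_pow_left₀ 2 hr hlt), e.left_inv hz⟩
  have hx0 : φ 0 x = x := φ.map_zero_apply x
  have hexy : e x = y := e.right_inv hyt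
  -- the orbit enters the ball at once
  have hstart : ∀ᶠ s in 𝓝[>] (0 : ℝ), φ s x ∈ B := by
    have hs0 : φ 0 x ∈ e.source := hx0.symm ▸ e.map_target hyt
    have h1 := ((hasDerivAt_norm_sub_sq (c := c) hW hs0).eventually_lt_of_neg (by
      rw [hx0, hexy]
      have := hneg y hy
      linarith)).1
    have h2 : ∀ᶠ s in 𝓝[>] (0 : ℝ), φ s x ∈ e.source :=
      (hcont.continuousAt.eventually_mem (e.open_source.mem_nhds hs0)).filter_mono
        nhdsWithin_le_nhds
    filter_upwards [h1, h2] with s hs hs'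
    rw [hx0, hexy, mem_sphere_iff_norm.1 hy] at hs
    exact hltB _ hs' hs
  obtain ⟨δ, hδ, hδB⟩ := mem_nhdsGT_iff_exists_Ioo_subset.1 hstart
  by_contra hcon
  -- the first exit time
  set A := {s : ℝ | 0 < s ∧ φ s x ∉ B} with hA
  have hAδ : ∀ s ∈ A, δ ≤ s := by
    rintro s ⟨hs, hsB⟩
    by_contra! hlt
    exact hsB (hδB ⟨hs, hlt⟩)
  have hAne : A.Nonempty := ⟨t, ht, hcon⟩
  have hAbdd : BddBelow A := ⟨δ, hAδ⟩
  set T := sInf A with hT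
  have hTδ : δ ≤ T := le_csInf hAne hAδ
  have hTpos : 0 < T := lt_of_lt_of_le hδ hTδ
  have hTB : φ T x ∉ B := by
    have hcl : IsClosed {s | φ s x ∉ B} := (hBo.preimage hcont).isClosed_compl
    exact hcl.closure_subset_iff.2 (fun s hs ↦ hs.2) (csInf_mem_closure hAne hAbdd)
  have hbefore : ∀ᶠ s in 𝓝[<] T, φ s x ∈ B := by
    filter_upwards [Ioo_mem_nhdsLT hTpos] with s hs
    by_contra hsB
    exact absurd (csInf_le hAbdd ⟨hs.1, hsB⟩) (not_le.2 hs.2)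
  obtain ⟨w, hw, hwT⟩ : φ T x ∈ e.symm '' Metric.closedBall c r := by
    refine hKc.mem_of_tendsto (b := 𝓝[<] T)
      (hcont.continuousAt.tendsto.mono_left nhdsWithin_le_nhds) ?_
    exact hbefore.mono fun s hs ↦ image_mono Metric.ball_subset_closedBall hs
  have hwS : w ∈ Metric.sphere c r := by
    rcases Metric.sphere_union_ball (x := c) (ε := r) ▸ hw with h | h
    · exact h
    · exact absurd (hwT ▸ mem_image_of_mem _ h) hTB
  have heT : e (φ T x) = w := by rw [← hwT, e.right_inv (hball hw)]
  have hTs : φ T x ∈ e.source := hwT ▸ e.map_target (hball hw)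
  have hafter := ((hasDerivAt_norm_sub_sq (c := c) hW hTs).eventually_lt_of_neg (by
      rw [heT]
      have := hneg w hwS
      linarith)).2
  obtain ⟨s, hs, hsB⟩ := (hafter.and hbefore).exists
  rw [heT, mem_sphere_iff_norm.1 hwS] at hs
  exact absurd (hBlt _ hsB) (not_lt.2 hs.le)

/-- A small coordinate sphere around the sink, along which the vector field points inwards, is a
cross-section of a gradient-like flow. -/
theorem IsGradientLike.isSphereSection [FiniteDimensional ℝ E] [T2Space M] [CompactSpace M]
    {F : M → ℝ} (h : IsGradientLike φ F p q) (hpq : p ≠ q) (hq : q ∈ e.source) (hr : 0 < r)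
    (hball : Metric.closedBall (e q) r ⊆ e.target)
    (hW : ∀ x t, φ t x ∈ e.source → HasDerivAt (fun s ↦ e (φ s x)) (W (e (φ t x))) t)
    (hneg : ∀ y ∈ Metric.closedBall (e q) r, y ≠ e q → inner ℝ (y - e q) (W y) < 0) :
    IsSphereSection φ p q fun θ ↦ e.symm (e q + r • θ) := by
  set c := e q with hc
  have hsph : ∀ θ ∈ Metric.sphere (0 : E) 1, c + r • θ ∈ Metric.sphere c r := by
    intro θ hθ
    rw [mem_sphere_zero_iff_norm] at hθ
    rw [mem_sphere_iff_norm, add_sub_cancel_left, norm_smul, hθ, mul_one, Real.norm_eq_abs,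
      abs_of_pos hr]
  have hsphball : ∀ y ∈ Metric.sphere c r, y ∈ Metric.closedBall c r := fun y hy ↦
    Metric.sphere_subset_closedBall hy
  have hnegS : ∀ y ∈ Metric.sphere c r, inner ℝ (y - c) (W y) < 0 := by
    intro y hy
    refine hneg y (hsphball y hy) ?_
    rintro rfl
    rw [mem_sphere_iff_norm, sub_self, norm_zero] at hy
    exact hr.ne hy
  have hsphB : ∀ y ∈ Metric.sphere c r, e.symm y ∉ e.symm '' Metric.ball c r := by
    rintro y hy ⟨w, hw, hwy⟩
    have := e.symm.injOn (hball (Metric.ball_subset_closedBall hw)) (hball (hsphball y hy)) hwy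
    subst this
    exact (Metric.mem_ball.1 hw).ne (Metric.mem_sphere.1 hy)
  have henter : ∀ y ∈ Metric.sphere c r, ∀ t, 0 < t →
      φ t (e.symm y) ∈ e.symm '' Metric.ball c r := fun y hy t ht ↦
    flow_mem_symm_image_ball hball hW hnegS hy ht
  have hpK : p ∉ e.symm '' Metric.closedBall c r := by
    rintro ⟨y, hy, rfl⟩
    have hyt := hball hy
    have hyc : y ≠ c := by
      rintro rfl
      exact hpq (e.left_inv hq)
    have h1 := hW (e.symm y) 0 (by rw [h.fixed_left]; exact e.map_target hyt)
    simp only [h.fixed_left, e.right_inv hyt] at h1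
    have h2 := h1.unique (hasDerivAt_const 0 y)
    have h3 := hneg y hy hyc
    rw [h2, inner_zero_right] at h3
    exact lt_irrefl _ h3
  refine ⟨?_, ?_, ?_, ?_, ?_⟩
  · refine (e.continuousOn_symm.mono hball).comp (by fun_prop) fun θ hθ ↦ hsphball _ (hsph θ hθ)
  · intro θ hθ hp
    exact hpK ⟨_, hsphball _ (hsph θ hθ), hp⟩
  · intro θ hθ hq'
    have h1 : e.symm (c + r • θ) = e.symm c := hq'.trans (e.left_inv hq).symm
    exact hsphB _ (hsph θ hθ) (h1 ▸ mem_image_of_mem _ (Metric.mem_ball_self hr))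
  · intro θ hθ θ' hθ' t ht
    rcases lt_trichotomy t 0 with h0 | h0 | h0
    · have h1 : φ (-t) (e.symm (c + r • θ')) = e.symm (c + r • θ) := by
        rw [← ht, ← φ.map_add, neg_add_cancel, φ.map_zero_apply]
      exact absurd (h1 ▸ henter _ (hsph θ' hθ') (-t) (neg_pos.2 h0)) (hsphB _ (hsph θ hθ))
    · refine ⟨h0, ?_⟩
      rw [h0, φ.map_zero_apply] at ht
      have h1 := e.symm.injOn (hball (hsphball _ (hsph θ hθ))) (hball (hsphball _ (hsph θ' hθ'))) ht
      exact smul_right_injective E hr.ne' (add_left_cancel h1)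
    · exact absurd (ht ▸ henter _ (hsph θ hθ) t h0) (hsphB _ (hsph θ' hθ'))
  · intro x hxp hxq
    have hBo : IsOpen (e.symm '' Metric.ball c r) := isOpen_symm_image_ball hball
    have hKo : IsOpen (e.symm '' Metric.closedBall c r)ᶜ :=
      ((isCompact_closedBall c r).image_of_continuousOn
        (e.continuousOn_symm.mono hball)).isClosed.isOpen_compl
    have hcont : Continuous fun s ↦ φ s x := φ.continuous continuous_id continuous_const
    have hqB : q ∈ e.symm '' Metric.ball c r := ⟨c, Metric.mem_ball_self hr, e.left_inv hq⟩
    -- the orbit runs from outside the closed ball to inside the open ball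
    obtain ⟨s, hs⟩ := ((h.tendsto_atTop hxp).eventually_mem (hBo.mem_nhds hqB)).exists
    obtain ⟨s', hs'⟩ := ((h.tendsto_atBot hxq).eventually_mem (hKo.mem_nhds hpK)).exists
    by_contra! hcon
    have hcover : (univ : Set ℝ) ⊆ (fun s ↦ φ s x) ⁻¹' (e.symm '' Metric.ball c r) ∪
        (fun s ↦ φ s x) ⁻¹' (e.symm '' Metric.closedBall c r)ᶜ := by
      intro t _
      by_cases ht : φ t x ∈ e.symm '' Metric.closedBall c r
      · left
        obtain ⟨y, hy, hyt⟩ := ht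
        rcases Metric.sphere_union_ball (x := c) (ε := r) ▸ hy with hyS | hyB
        · refine absurd ?_ (hcon (r⁻¹ • (y - c)) ?_ (-t))
          · rw [smul_inv_smul₀ hr.ne', add_sub_cancel, hyt, ← φ.map_add, neg_add_cancel,
              φ.map_zero_apply]
          · rw [mem_sphere_zero_iff_norm, norm_smul, mem_sphere_iff_norm.1 hyS, norm_inv,
              Real.norm_eq_abs, abs_of_pos hr, inv_mul_cancel₀ hr.ne']
        · exact ⟨y, hyB, hyt⟩
      · exact Or.inr ht
    obtain ⟨t, -, ht1, ht2⟩ := isPreconnected_univ _ _ (hBo.preimage hcont) (hKo.preimage hcont)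
      hcover ⟨s, mem_univ _, hs⟩ ⟨s', mem_univ _, hs'⟩
    exact ht2 (image_mono Metric.ball_subset_closedBall ht1)

end SphereSection

/-! ### First-order identities for concircular fields -/

section Concircular

variable {E : Type*} [NormedAddCommGroup E] [NormedSpace ℝ E]
  {H : Type*} [TopologicalSpace H] {I : ModelWithCorners ℝ E H}
  {M : Type*} [TopologicalSpace M] [ChartedSpace H M]

theorem IsMIntegralCurve.hasDerivAt_comp {v : Π x : M, TangentSpace I x} {γ : ℝ → M}
    (hγ : IsMIntegralCurve γ v) {F : M → ℝ} {t : ℝ} (hF : MDiffAt F (γ t)) :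
    HasDerivAt (fun s ↦ F (γ s)) (mvfderiv I F (γ t) (v (γ t))) t := by
  have h : HasMFDerivAt 𝓘(ℝ, ℝ) 𝓘(ℝ, ℝ) (F ∘ γ) t _ := hF.hasMFDerivAt.comp t (hγ t)
  have h' : HasFDerivAt (F ∘ γ)
      ((mvfderiv I F (γ t)).comp ((1 : ℝ →L[ℝ] ℝ).smulRight (v (γ t)))) t :=
    h.hasFDerivAt
  exact h'.hasDerivAt.congr_deriv (by simp)

theorem lieBracketWithin_eq_neg_fderiv {V V' W : E → E} {S : Set E} {c w : E} (hS : S = univ)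
    (hV : V =ᶠ[𝓝 c] V') (hVc : V c = 0) (hW : W c = w) :
    lieBracketWithin ℝ V W S c = -(fderiv ℝ V' c w) := by
  rw [hS, lieBracketWithin_univ, lieBracket_eq]
  change fderiv ℝ W c (V c) - fderiv ℝ V c (W c) = _
  rw [hVc, hW, map_zero, zero_sub, hV.fderiv_eq]

variable [FiniteDimensional ℝ E] [IsManifold I ∞ M]
  {g : ContMDiffRiemannianMetric I ∞ E (fun x : M ↦ TangentSpace I x)}
  {u : Π x : M, TangentSpace I x} {f ρ : M → ℝ}

namespace RiemGeom

theorem IsConcircular.mdifferentiableAt_field (hu : IsConcircular g u f) (x : M) :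
    MDiffAt (T% u) x :=
  (hu.smooth_field x).mdifferentiableAt (by simp)

theorem IsConcircular.mdifferentiableAt_potential (hu : IsConcircular g u f) (x : M) :
    MDiffAt f x :=
  (hu.smooth_potential x).mdifferentiableAt (by simp)

theorem IsConnectingFunction.mvfderiv_apply (hρ : IsConnectingFunction g u f ρ) (x : M)
    (v : TangentSpace I x) : mvfderiv I f x v = ρ x * g.inner x (u x) v := by
  rw [← inner_gradient g, hρ.gradient_eq]
  simp

/-- Metric compatibility turns `∇_u u = f u` into `u(g(u, u)) = 2 f g(u, u)`. -/
theorem IsConcircular.mvfderiv_inner_self (hu : IsConcircular g u f) (x : M) :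
    mvfderiv I (fun y ↦ g.inner y (u y) (u y)) x (u x) = 2 * f x * g.inner x (u x) (u x) := by
  have h := hu.mdifferentiableAt_field x
  rw [leviCivita_metric g h h h, hu.conn_eq]
  simp only [map_smul, smul_apply, smul_eq_mul]
  ring

theorem IsConcircular.contMDiff_one (hu : IsConcircular g u f) :
    CMDiff 1 (fun x ↦ (⟨x, u x⟩ : TangentBundle I M)) :=
  hu.smooth_field.of_le (by simp)

theorem IsConcircular.continuous_inner_self (hu : IsConcircular g u f) :
    Continuous fun x ↦ g.inner x (u x) (u x) :=
  continuous_iff_continuousAt.2 fun x ↦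
    (mdiff_inner g (hu.mdifferentiableAt_field x) (hu.mdifferentiableAt_field x)).continuousAt

theorem IsConcircular.hasDerivAt_potential (hu : IsConcircular g u f)
    (hρ : IsConnectingFunction g u f ρ) {γ : ℝ → M} (hγ : IsMIntegralCurve γ u) (t : ℝ) :
    HasDerivAt (fun s ↦ f (γ s)) (ρ (γ t) * g.inner (γ t) (u (γ t)) (u (γ t))) t := by
  have := hγ.hasDerivAt_comp (hu.mdifferentiableAt_potential (γ t))
  rwa [hρ.mvfderiv_apply] at this

theorem IsConcircular.hasDerivAt_inner_self (hu : IsConcircular g u f)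
    {γ : ℝ → M} (hγ : IsMIntegralCurve γ u) (t : ℝ) :
    HasDerivAt (fun s ↦ g.inner (γ s) (u (γ s)) (u (γ s)))
      (2 * f (γ t) * g.inner (γ t) (u (γ t)) (u (γ t))) t := by
  have h := hu.mdifferentiableAt_field (γ t)
  have := hγ.hasDerivAt_comp (F := fun y ↦ g.inner y (u y) (u y)) (mdiff_inner g h h)
  rwa [hu.mvfderiv_inner_self] at this

theorem IsConcircular.mlieBracket_eq (hu : IsConcircular g u f) {x : M} (hx : u x = 0)
    {X : Π y : M, TangentSpace I y} (hX : MDiffAt (T% X) x) :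
    mlieBracket I u X x = -(f x • X x) := by
  have h := (CovariantDerivative.torsion_eq_zero_iff (cov := leviCivita g)).1 (leviCivita_torsion g)
    (hu.mdifferentiableAt_field x) hX
  rw [← h, hu.conn_eq, hx, map_zero, zero_sub]

end RiemGeom

/-- At a zero of a concircular field, its linearization is multiplication by the potential. Since
the connection is torsion-free, `∇_X u = [X, u]` wherever `u` vanishes, and in a chart this bracket
is the derivative of `u` along `X`. -/
theorem RiemGeom.IsConcircular.fderiv_chartField [I.Boundaryless] (hu : IsConcircular g u f) {x : M}
    (hx : u x = 0) (w : E) :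
    fderiv ℝ (chartField I u x) (extChartAt I x x) w = f x • w := by
  obtain ⟨X, hX, hXw⟩ : ∃ X : Π y : M, TangentSpace I y, MDiffAt (T% X) x ∧ X x = w :=
    ⟨FiberBundle.extend E (show TangentSpace I x from w), FiberBundle.mdifferentiableAt_extend ..,
      FiberBundle.extend_apply_self E (show TangentSpace I x from w)⟩
  have h := hu.mlieBracket_eq hx hX
  have hev : mpullbackWithin 𝓘(ℝ, E) I (extChartAt I x).symm u (range I) =ᶠ[𝓝 (extChartAt I x x)]
      chartField I u x := by
    filter_upwards [extChartAt_target_mem_nhds x] with y hy using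
      mpullbackWithin_extChartAt_symm_eq_chartField u x hy
  have hV0 : mpullbackWithin 𝓘(ℝ, E) I (extChartAt I x).symm u (range I)
      (extChartAt I x x) = 0 := by
    rw [mpullbackWithin_apply, extChartAt_to_inv, hx]
    exact map_zero _
  have hWx : mpullbackWithin 𝓘(ℝ, E) I (extChartAt I x).symm X (range I) (extChartAt I x x) =
      (X x : E) := by
    -- the fibre of the tangent bundle over `y` is `E` for every `y`, so values can be compared
    have hX' : ∀ y, y = x → (X y : E) = X x := by
      rintro y rfl
      rfl
    rw [mpullbackWithin_apply, mfderivWithin_range_extChartAt_symm]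
    exact (congrArg (fun L : E →L[ℝ] E ↦ L _)
      (ContinuousLinearMap.inverse_id (R := ℝ) (M := E))).trans (hX' _ (extChartAt_to_inv x))
  have h1 : mlieBracket I u X x = (lieBracketWithin ℝ
      (mpullbackWithin 𝓘(ℝ, E) I (extChartAt I x).symm u (range I))
      (mpullbackWithin 𝓘(ℝ, E) I (extChartAt I x).symm X (range I)) (range I)
      (extChartAt I x x) : E) := by
    rw [← mlieBracketWithin_univ, mlieBracketWithin_apply, mfderiv_extChartAt_self, preimage_univ,
      univ_inter]
    exact congrArg (fun L : E →L[ℝ] E ↦ L _) (ContinuousLinearMap.inverse_id (R := ℝ) (M := E))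
  have h2 : lieBracketWithin ℝ
      (mpullbackWithin 𝓘(ℝ, E) I (extChartAt I x).symm u (range I))
      (mpullbackWithin 𝓘(ℝ, E) I (extChartAt I x).symm X (range I)) (range I)
      (extChartAt I x x) = -(fderiv ℝ (chartField I u x) (extChartAt I x x) w : E) :=
    lieBracketWithin_eq_neg_fderiv I.range_eq_univ hev hV0 (hWx.trans hXw)
  exact neg_injective (h2.symm.trans (h1.symm.trans (h.trans (hXw ▸ rfl))))

end Concircular

/-! ### The flow of a concircular field with two zeros -/

section Calculus

theorem eventually_inner_neg_of_hasFDerivAt {E : Type*} [NormedAddCommGroup E]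
    [InnerProductSpace ℝ E] {W : E → E} {c : E} {a : ℝ}
    (hW : HasFDerivAt W (a • ContinuousLinearMap.id ℝ E) c) (hc : W c = 0) (ha : a < 0) :
    ∀ᶠ y in 𝓝 c, y ≠ c → inner ℝ (y - c) (W y) < 0 := by
  have h := hW.isLittleO.bound (show 0 < -a / 2 by linarith)
  filter_upwards [h] with y hy hyc
  simp only [hc, sub_zero, smul_apply, ContinuousLinearMap.id_apply] at hy
  have hpos : 0 < ‖y - c‖ := norm_pos_iff.2 (sub_ne_zero.2 hyc)
  have h1 : inner ℝ (y - c) (W y) = a * ‖y - c‖ ^ 2 + inner ℝ (y - c) (W y - a • (y - c)) := by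
    rw [inner_sub_right, inner_smul_right, real_inner_self_eq_norm_sq]
    ring
  have h2 : inner ℝ (y - c) (W y - a • (y - c)) ≤ ‖y - c‖ * (-a / 2 * ‖y - c‖) :=
    (real_inner_le_norm _ _).trans (by gcongr)
  have h3 : a * ‖y - c‖ ^ 2 < 0 := mul_neg_of_neg_of_pos ha (by positivity)
  rw [h1]
  linarith [show ‖y - c‖ * (-a / 2 * ‖y - c‖) = -(a * ‖y - c‖ ^ 2) / 2 by ring]

/-- With `2 k ≥ 0` as logarithmic derivative, `N` would be nondecreasing and could not tend
to zero. -/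
theorem exists_neg_of_tendsto_atTop {k N : ℝ → ℝ} (hN : ∀ t, HasDerivAt N (2 * k t * N t) t)
    (hpos : ∀ t, 0 < N t) (htop : Tendsto N atTop (𝓝 0)) : ∃ t, k t < 0 := by
  by_contra! hk
  have hmono : Monotone N := monotone_of_hasDerivAt_nonneg hN fun t ↦
    mul_nonneg (mul_nonneg zero_le_two (hk t)) (hpos t).le
  exact absurd (hpos 0) (not_lt.2 (hmono.ge_of_tendsto htop 0))

/-- If `k` were monotone, it would be negative on a half-line `(-∞, t₀]`, where `N` then decreases
from its limit zero at `-∞`, contradicting positivity. -/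
theorem not_monotone_of_tendsto {k N : ℝ → ℝ} (hN : ∀ t, HasDerivAt N (2 * k t * N t) t)
    (hpos : ∀ t, 0 < N t) (htop : Tendsto N atTop (𝓝 0)) (hbot : Tendsto N atBot (𝓝 0)) :
    ¬ Monotone k := by
  intro hk
  obtain ⟨t₀, ht₀⟩ := exists_neg_of_tendsto_atTop hN hpos htop
  have hanti : AntitoneOn N (Iic t₀) := by
    refine antitoneOn_of_deriv_nonpos (convex_Iic t₀)
      (fun t _ ↦ (hN t).continuousAt.continuousWithinAt)
      (fun t _ ↦ (hN t).differentiableAt.differentiableWithinAt) fun t ht ↦ ?_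
    rw [(hN t).deriv]
    have : k t < 0 := (hk (show t ≤ t₀ from interior_subset (s := Iic t₀) ht)).trans_lt ht₀
    exact mul_nonpos_of_nonpos_of_nonneg (by linarith) (hpos t).le
  refine absurd (hpos t₀) (not_lt.2 (ge_of_tendsto hbot ?_))
  filter_upwards [eventually_le_atBot t₀] with t ht using hanti ht self_mem_Iic ht

end Calculus

section Flow

variable {E : Type*} [NormedAddCommGroup E] [NormedSpace ℝ E] [FiniteDimensional ℝ E]
  {H : Type*} [TopologicalSpace H] {I : ModelWithCorners ℝ E H} [I.Boundaryless]
  {M : Type*} [TopologicalSpace M] [ChartedSpace H M] [IsManifold I ∞ M]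
  {g : ContMDiffRiemannianMetric I ∞ E (fun x : M ↦ TangentSpace I x)}
  {u : Π x : M, TangentSpace I x} {f ρ : M → ℝ} {φ : Flow ℝ M}

namespace RiemGeom

variable [T2Space M]

theorem IsConcircular.flow_fixed (hu : IsConcircular g u f)
    (hφ : ∀ x, IsMIntegralCurve (fun t ↦ φ t x) u) {x : M} (hx : u x = 0) (t : ℝ) :
    φ t x = x :=
  congrFun (isMIntegralCurve_Ioo_eq_of_contMDiff_boundaryless (t₀ := 0) hu.contMDiff_one (hφ x)
    (isMIntegralCurve_const hx) (φ.map_zero_apply x)) t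

theorem IsConcircular.field_flow_ne_zero (hu : IsConcircular g u f)
    (hφ : ∀ x, IsMIntegralCurve (fun t ↦ φ t x) u) {x : M} (hx : u x ≠ 0) (t : ℝ) :
    u (φ t x) ≠ 0 := by
  intro h
  have h1 := hu.flow_fixed hφ h (-t)
  rw [← φ.map_add, neg_add_cancel, φ.map_zero_apply] at h1
  exact hx (h1 ▸ h)

variable [CompactSpace M] [ConnectedSpace M]

/-- If `u` has exactly two zeros, then its flow is gradient-like for `f` or `-f`, according to the
sign of the connecting function. -/
theorem IsConcircular.exists_isGradientLike (hu : IsConcircular g u f)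
    (hρ : IsConnectingFunction g u f ρ) (hzeros : {p : M | u p = 0}.ncard = 2)
    (hφ : ∀ x, IsMIntegralCurve (fun t ↦ φ t x) u) {s : ℝ} (hs : ∀ x, s * ρ x < 0) :
    ∃ p q, p ≠ q ∧ {x : M | u x = 0} = {p, q} ∧ IsGradientLike φ (fun x ↦ s * f x) p q := by
  obtain ⟨a, b, hab, hZ⟩ := Set.ncard_eq_two.1 hzeros
  set F : M → ℝ := fun x ↦ s * f x with hF
  have hFc : Continuous F := continuous_const.mul hu.smooth_potential.continuous
  have hFd : ∀ x t, HasDerivAt (fun τ ↦ F (φ τ x))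
      (s * ρ (φ t x) * g.inner (φ t x) (u (φ t x)) (u (φ t x))) t := by
    intro x t
    simpa only [mul_assoc] using (hu.hasDerivAt_potential hρ (hφ x) t).const_mul s
  -- extrema of `F` are zeros of `u`
  have hcrit : ∀ x, (IsExtrOn F univ x) → u x = 0 := by
    intro x hx
    by_contra hux
    have h1 : IsLocalExtr (fun τ ↦ F (φ τ x)) 0 := by
      refine hx.elim (fun h ↦ Or.inl ?_) fun h ↦ Or.inr ?_
      · exact Eventually.of_forall fun τ ↦ by simpa [φ.map_zero_apply] using h (mem_univ (φ τ x))
      · exact Eventually.of_forall fun τ ↦ by simpa [φ.map_zero_apply] using h (mem_univ (φ τ x))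
    have h2 := h1.hasDerivAt_eq_zero (hFd x 0)
    rw [φ.map_zero_apply] at h2
    exact (mul_neg_of_neg_of_pos (hs x) (g.pos x _ hux)).ne h2
  have hanti : ∀ x, u x ≠ 0 → StrictAnti fun t ↦ F (φ t x) := fun x hx ↦
    strictAnti_of_hasDerivAt_neg (hFd x) fun t ↦
      mul_neg_of_neg_of_pos (hs _) (g.pos _ _ (hu.field_flow_ne_zero hφ hx t))
  obtain ⟨p, -, hp⟩ := isCompact_univ.exists_isMaxOn univ_nonempty hFc.continuousOn
  obtain ⟨q, -, hq⟩ := isCompact_univ.exists_isMinOn univ_nonempty hFc.continuousOn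
  replace hp' : ∀ x, F x ≤ F p := fun x ↦ hp (mem_univ x)
  replace hq' : ∀ x, F q ≤ F x := fun x ↦ hq (mem_univ x)
  have hup : u p = 0 := hcrit p hp.isExtr
  have huq : u q = 0 := hcrit q hq.isExtr
  -- otherwise every point would be a zero
  have hlt : F q < F p := by
    refine lt_of_le_of_ne (hq' p) fun heq ↦ ?_
    have hall : ∀ x, u x = 0 := fun x ↦
      hcrit x (Or.inr fun y _ ↦ (hp' y).trans (heq ▸ hq' x))
    have hinf : (univ : Set M).Infinite :=
      isPreconnected_univ.infinite_of_nontrivial ⟨a, mem_univ a, b, mem_univ b, hab⟩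
    refine hinf ?_
    have : (univ : Set M) = {a, b} := by
      rw [← hZ]
      exact (eq_univ_of_forall hall).symm
    rw [this]
    exact toFinite _
  have hpq : p ≠ q := by
    rintro rfl
    exact lt_irrefl _ hlt
  have hZ' : {x : M | u x = 0} = {p, q} := by
    symm
    refine Set.eq_of_subset_of_ncard_le ?_ ?_ (hZ ▸ toFinite _)
    · rintro x (rfl | rfl)
      exacts [hup, huq]
    · rw [hzeros, Set.ncard_pair hpq]
  have hne : ∀ x, x ≠ p → x ≠ q → u x ≠ 0 := by
    intro x hxp hxq hx
    have : x ∈ ({p, q} : Set M) := hZ' ▸ hx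
    exact this.elim hxp hxq
  refine ⟨p, q, hpq, hZ', hFc, hu.flow_fixed hφ hup, hu.flow_fixed hφ huq,
    fun x hxp hxq ↦ hanti x (hne x hxp hxq), fun x hx ↦ ?_, fun x hx ↦ ?_⟩
  · by_cases hxq : x = q
    · exact hxq ▸ hlt
    · have := hanti x (hne x hx hxq) (neg_one_lt_zero)
      simp only [φ.map_zero_apply] at this
      exact this.trans_le (hp' _)
  · by_cases hxp : x = p
    · exact hxp ▸ hlt
    · have := hanti x (hne x hxp hx) zero_lt_one
      simp only [φ.map_zero_apply] at this
      exact (hq' _).trans_lt this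

/-- The squared length of `u` tends to zero at both ends of a nonconstant orbit and has
logarithmic derivative `2 f`. Hence `f` is not increasing along the orbits, and it is negative at
the sink. -/
theorem IsConcircular.exists_isGradientLike_potential (hu : IsConcircular g u f)
    (hρ : IsConnectingFunction g u f ρ) (hρ_ne : ∀ p, ρ p ≠ 0)
    (hzeros : {p : M | u p = 0}.ncard = 2) (hφ : ∀ x, IsMIntegralCurve (fun t ↦ φ t x) u) :
    ∃ p q, p ≠ q ∧ u q = 0 ∧ f q < 0 ∧ IsGradientLike φ f p q := by
  have hsign : (∀ x, ρ x < 0) ∨ ∀ x, 0 < ρ x := by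
    by_contra! hcon
    obtain ⟨⟨x, hx⟩, y, hy⟩ := hcon
    obtain ⟨z, hz⟩ := mem_range_of_exists_le_of_exists_ge hρ.smooth.continuous ⟨y, hy⟩ ⟨x, hx⟩
    exact hρ_ne z hz
  obtain ⟨s, hs1, hs⟩ : ∃ s : ℝ, (s = 1 ∨ s = -1) ∧ ∀ x, s * ρ x < 0 := by
    rcases hsign with h | h
    · exact ⟨1, Or.inl rfl, fun x ↦ by simpa using h x⟩
    · exact ⟨-1, Or.inr rfl, fun x ↦ by simpa using h x⟩
  obtain ⟨p, q, hpq, hZ, hgl⟩ := hu.exists_isGradientLike hρ hzeros hφ hs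
  have hup : u p = 0 := (Set.ext_iff.1 hZ p).2 (Or.inl rfl)
  have huq : u q = 0 := (Set.ext_iff.1 hZ q).2 (Or.inr rfl)
  obtain ⟨x, hx⟩ : ∃ x, x ∉ ({p, q} : Set M) := by
    have hinf : (univ : Set M).Infinite :=
      isPreconnected_univ.infinite_of_nontrivial ⟨p, mem_univ p, q, mem_univ q, hpq⟩
    by_contra! hcon
    exact hinf ((toFinite ({p, q} : Set M)).subset fun x _ ↦ hcon x)
  have hux : u x ≠ 0 := fun h ↦ hx (hZ ▸ h)
  have hxp : x ≠ p := fun h ↦ hx (Or.inl h)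
  have hxq : x ≠ q := fun h ↦ hx (Or.inr h)
  have hN := hu.hasDerivAt_inner_self (hφ x)
  have hpos := fun t ↦ g.pos _ _ (hu.field_flow_ne_zero hφ hux t)
  have hlim : ∀ {z : M} {l : Filter ℝ}, u z = 0 → Tendsto (fun t ↦ φ t x) l (𝓝 z) →
      Tendsto (fun t ↦ g.inner (φ t x) (u (φ t x)) (u (φ t x))) l (𝓝 0) := by
    intro z l hz hl
    have h := (hu.continuous_inner_self.tendsto z).comp hl
    simpa [hz, Function.comp_def] using h
  have htop := hlim huq (hgl.tendsto_atTop hxp)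
  have hbot := hlim hup (hgl.tendsto_atBot hxq)
  rcases hs1 with rfl | rfl
  · simp only [one_mul] at hgl
    obtain ⟨t, ht⟩ := exists_neg_of_tendsto_atTop hN hpos htop
    refine ⟨p, q, hpq, huq, ?_, hgl⟩
    exact (hgl.right_lt _ (flow_ne_of_fixed hgl.fixed_right hxq t)).trans ht
  · refine absurd (fun a b hab ↦ ?_) (not_monotone_of_tendsto hN hpos htop hbot)
    have := hgl.antitone x hab
    simpa using this

end RiemGeom

end Flow

theorem theorem5p1 {n : ℕ} {M : Type*} [TopologicalSpace M] [T2Space M]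
    [CompactSpace M] [ConnectedSpace M]
    [ChartedSpace (EuclideanSpace ℝ (Fin n)) M] [IsManifold (𝓡 n) ∞ M]
    (g : ContMDiffRiemannianMetric (𝓡 n) ∞ (EuclideanSpace ℝ (Fin n))
      (fun x : M ↦ TangentSpace (𝓡 n) x))
    (u : Π x : M, TangentSpace (𝓡 n) x) (f ρ : M → ℝ)
    (hu : RiemGeom.IsNontrivialConcircular g u f)
    (hρ : RiemGeom.IsConnectingFunction g u f ρ)
    (hρ_ne : ∀ p : M, ρ p ≠ 0)
    (hzeros : {p : M | u p = 0}.ncard = 2) :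
    Nonempty (M ≃ₜ Metric.sphere (0 : EuclideanSpace ℝ (Fin (n + 1))) 1) := by
  have hu' := hu.toIsConcircular
  have : IsManifold (𝓡 n) 1 M := IsManifold.of_le (n := ∞) (by simp)
  obtain ⟨φ, hφ⟩ := exists_flow_isMIntegralCurve hu'.contMDiff_one
  obtain ⟨p, q, hpq, huq, hfq, hgl⟩ :=
    hu'.exists_isGradientLike_potential hρ hρ_ne hzeros hφ
  set e := chartAt (EuclideanSpace ℝ (Fin n)) q
  have hq : q ∈ e.source := mem_chart_source _ q
  -- `u`, read in the chart at `q`, points inwards on all small spheres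
  have hWd : HasFDerivAt (chartField (𝓡 n) u q)
      (f q • ContinuousLinearMap.id ℝ (EuclideanSpace ℝ (Fin n))) (e q) := by
    have h := ((contDiffAt_chartField (hu'.contMDiff_one q)).differentiableAt
      one_ne_zero).hasFDerivAt
    refine h.congr_fderiv (ContinuousLinearMap.ext fun w ↦ ?_)
    exact hu'.fderiv_chartField huq w
  have hWq : chartField (𝓡 n) u q (e q) = 0 := chartField_eq_zero huq
  obtain ⟨r, hr, hball⟩ := Metric.nhds_basis_closedBall.mem_iff.1
    ((eventually_inner_neg_of_hasFDerivAt hWd hWq hfq).and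
      (e.open_target.mem_nhds (e.map_source hq)))
  have hσ := hgl.isSphereSection (e := e) (W := chartField (𝓡 n) u q) hpq hq hr
    (fun y hy ↦ (hball hy).2)
    (fun x t hx ↦ (hφ x).hasDerivAt_extChartAt_comp (by rwa [extChartAt_source]))
    (fun y hy ↦ (hball hy).1)
  obtain ⟨Ψ⟩ := nonempty_onePoint_homeomorph hgl hσ hpq
  exact ⟨Ψ.symm.trans (onePointEquivSphereOfFinrankEq (by simp))⟩
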